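/- For a real polynomial $P(z)=\sum_{k=0}^{d}a_kz^k$ of degree $d\ge 2$ with all coefficients $a_0,\dots,a_d$ nonzero, put $$q_k(P)=\frac{a_{k-1}^2}{a_{k-2}a_k},\qquad k=2,3,\dots,d.$$ For $n\in\mathbb N=\{1,2,\dots\}$ let $b_{2n}$ be the unique positive root of the equation $1-2\sum_{k=1}^{n}x^{-k^2/2}=0$. (i) Let $n\in\mathbb N$ and let $P$ be a real polynomial of degree $2n$ with all coefficients nonzero. If $|q_k(P)|\ge b_{2n}$ for all $k=2,3,\dots,2n$, then all complex zeros of $P$ are real. (ii) For every $n\in\mathbb N$ and every $\varepsilon>0$ there exists a real polynomial $P$ of degree $2n$ with all coefficients nonzero such that $|q_k(P)|>b_{2n}-\varepsilon$ for all $k=2,3,\dots,2n$ and $P$ has nonreal zeros. (iii) Let $n\in\mathbb N$ and let $P$ be a real polynomial of degree $2n+1$ with all coefficients nonzero. If $|q_k(P)|\ge b_{2n+2}$ for all $k=2,3,\dots,2n+1$, then all complex zeros of $P$ are real. (iv) For every $n\in\mathbb N$ and every $\varepsilon>0$ there exists a real polynomial $P$ of degree $2n+1$ with all coefficients nonzero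 such that $|q_k(P)|>b_{2n}-\varepsilon$ for all $k=2,3,\dots,2n+1$ and $P$ has nonreal zeros. (v) Let $P$ be a real polynomial of degree $3$ with all coefficients nonzero. If $|q_k(P)|\ge\sqrt{9+6\sqrt3}$ for $k=2,3$, then all complex zeros of $P$ are real. (vi) For every $\varepsilon>0$ there exists a real polynomial $P$ of degree $3$ with all coefficients nonzero such that $|q_k(P)|>\sqrt{9+6\sqrt3}-\varepsilon$ for $k=2,3$ and $P$ has nonreal zeros. -/

import Mathlib

open Polynomial

noncomputable section

/-- The second quotient `q_k(P) = a_{k-1}^2 / (a_{k-2} a_k)` of the coefficients of `P`.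
It is meant for `2 ≤ k ≤ deg P`. -/
def secondQuotient (P : ℝ[X]) (k : ℕ) : ℝ :=
  P.coeff (k - 1) ^ 2 / (P.coeff (k - 2) * P.coeff k)

/-- `x` is a positive root of the equation `1 - 2 ∑_{k=1}^n x^{-k²/2} = 0`. -/
def IsThetaRoot (n : ℕ) (x : ℝ) : Prop :=
  0 < x ∧ 1 - 2 * ∑ k ∈ Finset.Icc 1 n, x ^ (-(k : ℝ) ^ 2 / 2) = 0

/-- The number `b_{2n}`: the positive root of `1 - 2 ∑_{k=1}^n x^{-k²/2} = 0`. It exists and is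
unique for every `n ≥ 1` (see `existsUnique_isThetaRoot`); the argument is half of the index. -/
def bEven (n : ℕ) : ℝ := Classical.epsilon (IsThetaRoot n)

/-- All complex zeros of the real polynomial `P` are real. -/
def AllZerosReal (P : ℝ[X]) : Prop := ∀ z : ℂ, aeval z P = 0 → z.im = 0

/-- The real polynomial `P` has a nonreal complex zero. -/
def HasNonrealZero (P : ℝ[X]) : Prop := ∃ z : ℂ, aeval z P = 0 ∧ z.im ≠ 0

/-- `P` has degree `d` and all its coefficients `a_0, …, a_d` are nonzero. -/
def HasDegreeAndNonzeroCoeffs (P : ℝ[X]) (d : ℕ) : Prop :=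
  P.natDegree = d ∧ ∀ k ≤ d, P.coeff k ≠ 0

theorem existsUnique_isThetaRoot (n : ℕ) (hn : 1 ≤ n) : ∃! x : ℝ, IsThetaRoot n x := by
  have hanti : ∀ x y : ℝ, 0 < x → x < y →
      ∑ k ∈ Finset.Icc 1 n, y ^ (-(k : ℝ) ^ 2 / 2) <
        ∑ k ∈ Finset.Icc 1 n, x ^ (-(k : ℝ) ^ 2 / 2) := by
    intro x y hx hxy
    refine Finset.sum_lt_sum_of_nonempty ⟨1, by simp [hn]⟩ fun k hk => ?_
    have hk1 : (1 : ℝ) ≤ k := by exact_mod_cast (Finset.mem_Icc.1 hk).1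
    exact Real.rpow_lt_rpow_of_neg hx hxy (by nlinarith)
  have hn1 : (1 : ℝ) ≤ n := by exact_mod_cast hn
  have hcont : ContinuousOn
      (fun x : ℝ => 1 - 2 * ∑ k ∈ Finset.Icc 1 n, x ^ (-(k : ℝ) ^ 2 / 2))
      (Set.Icc 1 ((2 * (n : ℝ)) ^ 2)) := by
    refine continuousOn_const.sub (continuousOn_const.mul (continuousOn_finsetSum _ fun k _ => ?_))
    refine continuousOn_id.rpow_const fun x hx => Or.inl ?_
    have := hx.1
    simp only [id]
    linarith
  have hle : (1 : ℝ) ≤ (2 * (n : ℝ)) ^ 2 := by nlinarith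
  have hmem : (0 : ℝ) ∈ Set.Icc
      (1 - 2 * ∑ k ∈ Finset.Icc 1 n, (1 : ℝ) ^ (-(k : ℝ) ^ 2 / 2))
      (1 - 2 * ∑ k ∈ Finset.Icc 1 n, ((2 * (n : ℝ)) ^ 2) ^ (-(k : ℝ) ^ 2 / 2)) := by
    constructor
    · simp only [Real.one_rpow, Finset.sum_const, Nat.card_Icc, Nat.add_sub_cancel, nsmul_eq_mul,
        mul_one]
      linarith
    · have hb : ∑ k ∈ Finset.Icc 1 n, ((2 * (n : ℝ)) ^ 2) ^ (-(k : ℝ) ^ 2 / 2) ≤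
          ∑ _k ∈ Finset.Icc 1 n, (2 * (n : ℝ))⁻¹ := by
        refine Finset.sum_le_sum fun k hk => ?_
        have hk1 : (1 : ℝ) ≤ k := by exact_mod_cast (Finset.mem_Icc.1 hk).1
        have h2 : (((2 * (n : ℝ)) ^ 2) : ℝ) ^ (-(1 : ℝ) / 2) = (2 * (n : ℝ))⁻¹ := by
          rw [← Real.rpow_natCast, ← Real.rpow_mul (by positivity)]
          norm_num
          rw [Real.rpow_neg_one, mul_inv]
          ring
        rw [← h2]
        exact Real.rpow_le_rpow_of_exponent_le hle (by nlinarith)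
      simp only [Finset.sum_const, Nat.card_Icc, Nat.add_sub_cancel, nsmul_eq_mul] at hb
      have : (n : ℝ) * (2 * (n : ℝ))⁻¹ = 1 / 2 := by field_simp
      linarith
  obtain ⟨x, hx, hx0⟩ := intermediate_value_Icc hle hcont hmem
  refine ⟨x, ⟨by linarith [hx.1], hx0⟩, ?_⟩
  rintro y ⟨hy, hy0⟩
  simp only at hx0
  rcases lt_trichotomy y x with h | h | h
  · have := hanti y x hy h
    linarith
  · exact h
  · have := hanti x y (by linarith [hx.1]) h
    linarith

theorem bEven_spec (n : ℕ) (hn : 1 ≤ n) : IsThetaRoot n (bEven n) :=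
  Classical.epsilon_spec (existsUnique_isThetaRoot n hn).exists

end

/-!
A term `a_j z^j` of `P` which on the circle `|z| = x_j` outweighs the sum of all the others
dictates the signs of `P(± x_j)`. If every term of `P` dominates at some radius, then a zero of `P`
lies between any two consecutive radii, on the positive or on the negative half-line according to
the signs of the two coefficients, and all zeros of `P` are real and simple.

If `|q_k| ≥ t⁻²` for all `k`, choose `x` so that the terms of index `j - 1` and `j + 1` have equal
modulus. On both sides of the `j`-th term the moduli then decay at least like `t^{m²}`, so the
`j`-th term dominates as soon as `∑_{m ≤ j} t^{m²} + ∑_{m ≤ d - j} t^{m²} < 1`. For `d ≤ 2n` the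
left side is at most `2 ∑_{m ≤ n} t^{m²}`, which equals `1` exactly for `t = b_{2n}^{-1/2}`. The
borderline case is the limit `θ → 1` of the polynomials with coefficients `a_k θ^{k²}`.

Conversely, let `a_k = ± s^{k²}` with a plus sign at `k = n` only. By the inequality of arithmetic
and geometric means `P < 0` on the positive half-line if `2 ∑_{m ≤ n} s^{m²} > 1`. If all zeros of
`P` were real, they would be nonpositive, and all coefficients would have the same sign.

In degree three the sign of the discriminant decides; in terms of `u = 1 / q_2` and `v = 1 / q_3` it
is that of `1 - 4u - 4v + 18uv - 27u²v²`, whose minimum over `|u|, |v| ≤ t` is attained at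
`u = -v = ± t`.
-/

open Filter Topology Asymptotics

/-! ### Real-rooted polynomials -/

theorem leadingCoeff_mul_abs_im_pow_le_norm_aeval {P : ℝ[X]} (hP : P.Splits) (z : ℂ) :
    |P.leadingCoeff| * |z.im| ^ P.natDegree ≤ ‖aeval z P‖ := by
  have hfactor : ‖aeval z P‖ = |P.leadingCoeff| * (P.roots.map fun r : ℝ => ‖z - r‖).prod := by
    conv_lhs => rw [hP.eq_prod_roots]
    rw [map_mul, aeval_C, map_multiset_prod, norm_mul, Complex.coe_algebraMap, Complex.norm_real,
      Real.norm_eq_abs, ← normHom_apply, map_multiset_prod, Multiset.map_map, Multiset.map_map]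
    simp
  have hroots : (P.roots.map fun _ => |z.im|).prod ≤ (P.roots.map fun r : ℝ => ‖z - r‖).prod :=
    Multiset.prod_map_le_prod_map₀ _ _ (fun _ _ => abs_nonneg _) fun r _ => by
      simpa using Complex.abs_im_le_norm (z - r)
  rw [Multiset.map_const', Multiset.prod_replicate, ← hP.natDegree_eq_card_roots] at hroots
  rw [hfactor]
  gcongr

theorem allZerosReal_iff_splits {P : ℝ[X]} (hP : P ≠ 0) : AllZerosReal P ↔ P.Splits := by
  refine ⟨fun h => ?_, fun h z hz => ?_⟩
  · refine Splits.of_splits_map (algebraMap ℝ ℂ) (IsAlgClosed.splits _) fun z hz => ?_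
    have hz0 : aeval z P = 0 := by
      rw [aeval_def, ← eval_map]
      exact (mem_roots'.1 hz).2
    exact ⟨z.re, Complex.ext (by simp) (by simp [h z hz0])⟩
  · by_contra him
    refine (leadingCoeff_mul_abs_im_pow_le_norm_aeval h z).not_gt ?_
    rw [hz, norm_zero]
    exact mul_pos (abs_pos.2 (leadingCoeff_ne_zero.2 hP)) (pow_pos (abs_pos.2 him) _)

theorem hasNonrealZero_iff_not_splits {P : ℝ[X]} (hP : P ≠ 0) :
    HasNonrealZero P ↔ ¬ P.Splits := by
  rw [← allZerosReal_iff_splits hP]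
  simp only [AllZerosReal, HasNonrealZero, not_forall, exists_prop, ne_eq]

theorem splits_of_tendsto_coeff {ι : Type*} {l : Filter ι} [l.NeBot] {F : ι → ℝ[X]} {P : ℝ[X]}
    (hcoeff : ∀ k, Tendsto (fun i => (F i).coeff k) l (𝓝 (P.coeff k)))
    (hdeg : ∀ᶠ i in l, (F i).natDegree = P.natDegree) (hF : ∀ᶠ i in l, (F i).Splits) :
    P.Splits := by
  rcases eq_or_ne P 0 with rfl | hP
  · exact Splits.zero
  refine (allZerosReal_iff_splits hP).1 fun z hz => ?_
  have hbound : ∀ᶠ i in l, |(F i).coeff P.natDegree| * |z.im| ^ P.natDegree ≤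
      ‖∑ k ∈ Finset.range (P.natDegree + 1), (F i).coeff k • z ^ k‖ := by
    filter_upwards [hdeg, hF] with i hi hs
    simpa only [leadingCoeff, aeval_eq_sum_range, hi] using
      leadingCoeff_mul_abs_im_pow_le_norm_aeval hs z
  have hlimit : |P.leadingCoeff| * |z.im| ^ P.natDegree ≤ ‖aeval z P‖ := by
    rw [aeval_eq_sum_range]
    exact le_of_tendsto_of_tendsto ((hcoeff _).abs.mul_const _)
      (tendsto_finsetSum _ fun k _ => (hcoeff k).smul_const _).norm hbound
  by_contra him
  rw [hz, norm_zero] at hlimit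
  exact hlimit.not_gt
    (mul_pos (abs_pos.2 (leadingCoeff_ne_zero.2 hP)) (pow_pos (abs_pos.2 him) _))

theorem leadingCoeff_mul_coeff_nonneg_of_splits {K : Type*} [Field K] [LinearOrder K]
    [IsStrictOrderedRing K] {P : K[X]} (hP : P.Splits) (hroots : ∀ x, 0 < x → ¬ P.IsRoot x)
    (k : ℕ) : 0 ≤ P.leadingCoeff * P.coeff k := by
  rcases lt_or_ge P.natDegree k with hk | hk
  · rw [coeff_eq_zero_of_natDegree_lt hk, mul_zero]
  have hvieta : P.coeff k =
      P.leadingCoeff * (P.roots.map Neg.neg).esymm (P.natDegree - k) := by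
    rw [coeff_eq_esymm_roots_of_splits hP hk, Multiset.esymm_neg, mul_assoc]
  have hesymm : 0 ≤ (P.roots.map Neg.neg).esymm (P.natDegree - k) := by
    refine Multiset.sum_nonneg fun y hy => ?_
    obtain ⟨s, hs, rfl⟩ := Multiset.mem_map.1 hy
    refine Multiset.prod_nonneg fun x hx => ?_
    obtain ⟨r, hr, rfl⟩ :=
      Multiset.mem_map.1 (Multiset.mem_of_le (Multiset.mem_powersetCard.1 hs).1 hx)
    exact neg_nonneg.2 (not_lt.1 fun h => hroots r h (mem_roots'.1 hr).2)
  rw [hvieta, ← mul_assoc]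
  exact mul_nonneg (mul_self_nonneg _) hesymm

theorem splits_of_injOn_isRoot {R : Type*} [CommRing R] [IsDomain R] {P : R[X]} (hP : P ≠ 0)
    {r : ℕ → R} (hinj : Set.InjOn r (Set.Iio P.natDegree))
    (hr : ∀ j < P.natDegree, P.IsRoot (r j)) : P.Splits := by
  classical
  refine splits_iff_card_roots.2 (le_antisymm (card_roots' P) ?_)
  calc P.natDegree = (Finset.range P.natDegree).card := (Finset.card_range _).symm
    _ ≤ P.roots.toFinset.card := by
      refine Finset.card_le_card_of_injOn r (fun j hj => ?_) (by simpa using hinj)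
      simpa [hP] using hr j (by simpa using hj)
    _ ≤ P.roots.card := Multiset.toFinset_card_le _

/-! ### Dominant terms -/

theorem exists_mem_Ioo_eq_zero_of_mul_neg {f : ℝ → ℝ} {a b : ℝ} (hab : a ≤ b)
    (hf : ContinuousOn f (Set.Icc a b)) (h : f a * f b < 0) : ∃ c ∈ Set.Ioo a b, f c = 0 := by
  rcases mul_neg_iff.1 h with h | h
  · exact intermediate_value_Ioo' hab hf ⟨h.2, h.1⟩
  · exact intermediate_value_Ioo hab hf h

/-- The term of index `j` of `P` dominates at the radius `x`: on the circle of radius `x` its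
modulus exceeds the sum of the moduli of all other terms. -/
def IsDominantAt (P : ℝ[X]) (j : ℕ) (x : ℝ) : Prop :=
  0 ≤ x ∧
    ∑ k ∈ (Finset.range (P.natDegree + 1)).erase j, |P.coeff k| * x ^ k < |P.coeff j| * x ^ j

namespace IsDominantAt

variable {P : ℝ[X]} {j k : ℕ} {x y : ℝ}

theorem term_pos (h : IsDominantAt P j x) : 0 < |P.coeff j| * x ^ j :=
  (Finset.sum_nonneg fun _ _ => mul_nonneg (abs_nonneg _) (pow_nonneg h.1 _)).trans_lt h.2

theorem coeff_ne_zero (h : IsDominantAt P j x) : P.coeff j ≠ 0 := fun h0 => by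
  simpa [h0] using h.term_pos

theorem pow_pos (h : IsDominantAt P j x) : 0 < x ^ j :=
  pos_of_mul_pos_right h.term_pos (abs_nonneg _)

theorem term_lt (h : IsDominantAt P j x) (hkj : k ≠ j) (hk : k ≤ P.natDegree) :
    |P.coeff k| * x ^ k < |P.coeff j| * x ^ j :=
  (Finset.single_le_sum (f := fun k => |P.coeff k| * x ^ k)
    (fun _ _ => mul_nonneg (abs_nonneg _) (pow_nonneg h.1 _))
    (Finset.mem_erase.2 ⟨hkj, Finset.mem_range_succ_iff.2 hk⟩)).trans_lt h.2

theorem lt_of_lt (hx : IsDominantAt P j x) (hy : IsDominantAt P k y) (hjk : j < k) : x < y := by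
  by_contra! hyx
  obtain ⟨i, rfl⟩ := Nat.exists_eq_add_of_lt hjk
  have hk := hx.term_lt hjk.ne' (le_natDegree_of_ne_zero hy.coeff_ne_zero)
  have hj := hy.term_lt hjk.ne (le_natDegree_of_ne_zero hx.coeff_ne_zero)
  rw [add_assoc, pow_add, mul_comm (_ ^ j), ← mul_assoc] at hk hj
  have hcoeff : |P.coeff j| < |P.coeff (j + (i + 1))| * x ^ (i + 1) :=
    (lt_of_mul_lt_mul_right hj (pow_nonneg hy.1 _)).trans_le <|
      mul_le_mul_of_nonneg_left (pow_le_pow_left₀ hy.1 hyx _) (abs_nonneg _)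
  exact hk.not_gt (mul_lt_mul_of_pos_right hcoeff hx.pow_pos)

theorem eval_mul_term_pos (h : IsDominantAt P j |y|) : 0 < P.eval y * (P.coeff j * y ^ j) := by
  have hj : j ∈ Finset.range (P.natDegree + 1) :=
    Finset.mem_range_succ_iff.2 (le_natDegree_of_ne_zero h.coeff_ne_zero)
  have hclose : |P.eval y - P.coeff j * y ^ j| < |P.coeff j * y ^ j| := by
    rw [eval_eq_sum_range, ← Finset.add_sum_erase _ _ hj, add_sub_cancel_left]
    refine (Finset.abs_sum_le_sum_abs _ _).trans_lt ?_
    simpa only [abs_mul, abs_pow] using h.2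
  linarith [sq_lt_sq.2 hclose, sq_nonneg (P.eval y)]

theorem exists_isRoot_abs_mem_Ioo (hx : IsDominantAt P j x) (hy : IsDominantAt P (j + 1) y) :
    ∃ r, P.IsRoot r ∧ |r| ∈ Set.Ioo x y := by
  obtain ⟨s, hs, hsneg⟩ : ∃ s : ℝ, |s| = 1 ∧ P.coeff j * P.coeff (j + 1) * s < 0 := by
    rcases lt_or_gt_of_ne (mul_ne_zero hx.coeff_ne_zero hy.coeff_ne_zero) with h | h
    · exact ⟨1, by simp, by linarith⟩
    · exact ⟨-1, by simp, by linarith⟩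
  have habs : ∀ {c : ℝ}, 0 ≤ c → |s * c| = c := fun hc => by
    rw [abs_mul, hs, one_mul, abs_of_nonneg hc]
  have hterms : P.coeff j * (s * x) ^ j * (P.coeff (j + 1) * (s * y) ^ (j + 1)) < 0 :=
    calc P.coeff j * (s * x) ^ j * (P.coeff (j + 1) * (s * y) ^ (j + 1))
        = P.coeff j * P.coeff (j + 1) * s * (s ^ 2) ^ j * (x ^ j * y ^ (j + 1)) := by ring
      _ = P.coeff j * P.coeff (j + 1) * s * (x ^ j * y ^ (j + 1)) := by
        rw [← sq_abs, hs, one_pow, one_pow, mul_one]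
      _ < 0 := mul_neg_of_neg_of_pos hsneg (mul_pos hx.pow_pos hy.pow_pos)
  have hvalues : P.eval (s * x) * P.eval (s * y) < 0 := by
    have hpos := mul_pos (eval_mul_term_pos (y := s * x) (by rwa [habs hx.1]))
      (eval_mul_term_pos (y := s * y) (by rwa [habs hy.1]))
    rw [mul_mul_mul_comm] at hpos
    exact (neg_iff_neg_of_mul_pos hpos).2 hterms
  obtain ⟨c, hc, hroot⟩ := exists_mem_Ioo_eq_zero_of_mul_neg
    (f := fun c => P.eval (s * c)) (hx.lt_of_lt hy j.lt_succ_self).le (by fun_prop) hvalues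
  exact ⟨s * c, hroot, by rwa [habs (hx.1.trans hc.1.le)]⟩

end IsDominantAt

theorem splits_of_forall_exists_isDominantAt {P : ℝ[X]}
    (h : ∀ j ≤ P.natDegree, ∃ x, IsDominantAt P j x) : P.Splits := by
  choose! x hx using h
  have hroots : ∀ j < P.natDegree, ∃ r, P.IsRoot r ∧ |r| ∈ Set.Ioo (x j) (x (j + 1)) :=
    fun j hj => (hx j hj.le).exists_isRoot_abs_mem_Ioo (hx (j + 1) hj)
  choose! r hr hmem using hroots
  have hmono : StrictMonoOn (fun j => |r j|) (Set.Iio P.natDegree) :=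
    strictMonoOn_of_lt_add_one Set.ordConnected_Iio fun j _ hj hj' =>
      (hmem j hj).2.trans (hmem (j + 1) hj').1
  have hP : P ≠ 0 := fun h0 => (hx 0 (Nat.zero_le _)).coeff_ne_zero (by simp [h0])
  exact splits_of_injOn_isRoot hP (fun i hi j hj hij => hmono.injOn hi hj (congrArg abs hij)) hr

theorem isDominantAt_zero {P : ℝ[X]} (h0 : P.coeff 0 ≠ 0) : IsDominantAt P 0 0 := by
  refine ⟨le_rfl, ?_⟩
  rw [Finset.sum_eq_zero fun k hk => by simp [Finset.ne_of_mem_erase hk]]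
  simpa using h0

theorem exists_isDominantAt_natDegree {P : ℝ[X]} (hP : P ≠ 0) :
    ∃ x, IsDominantAt P P.natDegree x := by
  have hlead : 0 < |P.coeff P.natDegree| := abs_pos.2 (leadingCoeff_ne_zero.2 hP)
  have hlittle : (fun x : ℝ => ∑ k ∈ Finset.range P.natDegree, |P.coeff k| * x ^ k) =o[atTop]
      fun x => x ^ P.natDegree :=
    .fun_sum fun k hk => (isLittleO_pow_pow_atTop_of_lt (Finset.mem_range.1 hk)).const_mul_left _
  obtain ⟨x, hx, hpos⟩ := ((hlittle.def (half_pos hlead)).and (eventually_gt_atTop 0)).exists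
  refine ⟨x, hpos.le, ?_⟩
  rw [Finset.range_add_one, Finset.erase_insert Finset.notMem_range_self]
  rw [Real.norm_of_nonneg (pow_nonneg hpos.le _)] at hx
  linarith [Real.le_norm_self (∑ k ∈ Finset.range P.natDegree, |P.coeff k| * x ^ k),
    mul_pos hlead (pow_pos hpos P.natDegree)]

/-! ### Partial theta sums -/

/-- The partial sum `∑_{k=1}^n t^{k²}` of the theta series; with `t = b^{-1/2}` this is the sum in
the equation defining `b_{2n}`. -/
def thetaSum {R : Type*} [Semiring R] (t : R) (n : ℕ) : R :=
  ∑ k ∈ Finset.Icc 1 n, t ^ (k ^ 2)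

theorem thetaSum_succ {R : Type*} [Semiring R] (t : R) (n : ℕ) :
    thetaSum t (n + 1) = thetaSum t n + t ^ ((n + 1) ^ 2) :=
  Finset.sum_Icc_succ_top (Nat.le_add_left 1 n) _

section ThetaSum

variable {R : Type*} [CommRing R] [LinearOrder R] [IsStrictOrderedRing R] {s t : R} {i j m n : ℕ}

theorem thetaSum_mono (ht : 0 ≤ t) : Monotone (thetaSum t) :=
  monotone_nat_of_le_succ fun n => by
    rw [thetaSum_succ]
    exact le_add_of_nonneg_right (pow_nonneg ht _)

theorem thetaSum_lt (hs : 0 ≤ s) (hst : s < t) (hn : 1 ≤ n) : thetaSum s n < thetaSum t n :=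
  Finset.sum_lt_sum_of_nonempty ⟨1, Finset.mem_Icc.2 ⟨le_rfl, hn⟩⟩ fun _ hk =>
    pow_lt_pow_left₀ hst hs (pow_pos (Finset.mem_Icc.1 hk).1 2).ne'

theorem thetaSum_add_thetaSum_le_two_mul (ht : 0 ≤ t) (ht1 : t ≤ 1) (i m : ℕ) :
    thetaSum t i + thetaSum t (i + 2 * m) ≤ 2 * thetaSum t (i + m) := by
  induction m generalizing i with
  | zero => rw [mul_zero, add_zero, two_mul]
  | succ m ih =>
    have hincr : t ^ ((i + 2 * m + 1 + 1) ^ 2) ≤ t ^ ((i + 1) ^ 2) :=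
      pow_le_pow_of_le_one ht ht1 (Nat.pow_le_pow_left (by omega) 2)
    have hih := ih (i + 1)
    rw [show i + 1 + 2 * m = i + 2 * m + 1 by ring, thetaSum_succ t i,
      show i + 1 + m = i + (m + 1) by ring] at hih
    rw [show i + 2 * (m + 1) = i + 2 * m + 1 + 1 by ring, thetaSum_succ]
    linarith

theorem thetaSum_add_thetaSum_le (ht : 0 ≤ t) (ht1 : t ≤ 1) (hij : i + j ≤ 2 * n) :
    thetaSum t i + thetaSum t j ≤ 2 * thetaSum t n := by
  wlog h : i ≤ j generalizing i j
  · rw [add_comm]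
    exact this (by omega) (by omega)
  calc thetaSum t i + thetaSum t j ≤ thetaSum t i + thetaSum t (i + 2 * (n - i)) := by
        gcongr
        exact thetaSum_mono ht (by omega)
    _ ≤ 2 * thetaSum t (i + (n - i)) := thetaSum_add_thetaSum_le_two_mul ht ht1 i _
    _ = 2 * thetaSum t n := by rw [Nat.add_sub_cancel' (by omega)]

end ThetaSum

/-! ### Strongly log-concave sequences -/

/-- The numbers `w 0, …, w d` are positive and all their second quotients
`w (k + 1) ^ 2 / (w k * w (k + 2))` are at least `t⁻²`. -/
structure IsStronglyLogConcave {R : Type*} [Semiring R] [LinearOrder R] (t : R) (d : ℕ)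
    (w : ℕ → R) : Prop where
  pos : ∀ k ≤ d, 0 < w k
  mul_le : ∀ k, k + 2 ≤ d → w k * w (k + 2) ≤ t ^ 2 * w (k + 1) ^ 2

theorem sum_range_erase_eq_sum_Icc_add_sum_Icc {M : Type*} [AddCommMonoid M] (w : ℕ → M) (i j : ℕ) :
    ∑ k ∈ (Finset.range (j + i + 1)).erase j, w k =
      ∑ m ∈ Finset.Icc 1 j, w (j - m) + ∑ m ∈ Finset.Icc 1 i, w (j + m) := by
  have hsplit : (Finset.range (j + i + 1)).erase j =
      Finset.range j ∪ Finset.Icc (j + 1) (j + i) := by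
    grind
  have hbelow : ∑ k ∈ Finset.range j, w k = ∑ m ∈ Finset.Icc 1 j, w (j - m) :=
    Finset.sum_nbij' (j - ·) (j - ·) (by grind) (by grind) (by grind) (by grind) (by grind)
  have habove : ∑ k ∈ Finset.Icc (j + 1) (j + i), w k = ∑ m ∈ Finset.Icc 1 i, w (j + m) :=
    Finset.sum_nbij' (· - j) (j + ·) (by grind) (by grind) (by grind) (by grind) (by grind)
  rw [hsplit, Finset.sum_union (Finset.disjoint_left.2 (by grind)), hbelow, habove]

namespace IsStronglyLogConcave

variable {R : Type*} [CommRing R] [LinearOrder R] {t θ x : R} {d j m : ℕ} {w : ℕ → R}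

theorem shift (h : IsStronglyLogConcave t d w) (hj : j ≤ d) :
    IsStronglyLogConcave t (d - j) fun m => w (j + m) where
  pos k hk := h.pos _ (by omega)
  mul_le k hk := h.mul_le (j + k) (by omega)

theorem reverse (h : IsStronglyLogConcave t d w) (hj : j ≤ d) :
    IsStronglyLogConcave t j fun m => w (j - m) where
  pos k hk := h.pos _ (by omega)
  mul_le k hk := by
    obtain ⟨i, rfl⟩ := Nat.exists_eq_add_of_le' hk
    have := h.mul_le i (by omega)
    rw [mul_comm]
    convert this using 3 <;> congr 1 <;> omega

variable [IsStrictOrderedRing R]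

theorem mul_pow_sq (h : IsStronglyLogConcave t d w) (hθ : 0 < θ) :
    IsStronglyLogConcave (θ * t) d fun k => w k * θ ^ (k ^ 2) where
  pos k hk := mul_pos (h.pos k hk) (pow_pos hθ _)
  mul_le k hk :=
    calc w k * θ ^ k ^ 2 * (w (k + 2) * θ ^ (k + 2) ^ 2)
        = w k * w (k + 2) * (θ ^ 2 * (θ ^ (k + 1) ^ 2) ^ 2) := by ring
      _ ≤ t ^ 2 * w (k + 1) ^ 2 * (θ ^ 2 * (θ ^ (k + 1) ^ 2) ^ 2) :=
        mul_le_mul_of_nonneg_right (h.mul_le k hk) (mul_nonneg (sq_nonneg _) (sq_nonneg _))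
      _ = (θ * t) ^ 2 * (w (k + 1) * θ ^ (k + 1) ^ 2) ^ 2 := by ring

theorem mul_pow (h : IsStronglyLogConcave t d w) (hx : 0 < x) :
    IsStronglyLogConcave t d fun k => w k * x ^ k where
  pos k hk := mul_pos (h.pos k hk) (pow_pos hx _)
  mul_le k hk :=
    calc w k * x ^ k * (w (k + 2) * x ^ (k + 2))
        = w k * w (k + 2) * (x ^ (k + 1)) ^ 2 := by ring
      _ ≤ t ^ 2 * w (k + 1) ^ 2 * (x ^ (k + 1)) ^ 2 :=
        mul_le_mul_of_nonneg_right (h.mul_le k hk) (sq_nonneg _)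
      _ = t ^ 2 * (w (k + 1) * x ^ (k + 1)) ^ 2 := by ring

theorem succ_le_pow_mul (h : IsStronglyLogConcave t d w) (h1 : w 1 ≤ t * w 0)
    (hm : m < d) : w (m + 1) ≤ t ^ (2 * m + 1) * w m := by
  induction m with
  | zero => simpa using h1
  | succ m ih =>
    refine le_of_mul_le_mul_left ?_ (h.pos m (by omega))
    calc w m * w (m + 2) ≤ t ^ 2 * (w (m + 1) * w (m + 1)) := by
          rw [← pow_two]
          exact h.mul_le m hm
      _ ≤ t ^ 2 * (t ^ (2 * m + 1) * w m * w (m + 1)) :=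
        mul_le_mul_of_nonneg_left (mul_le_mul_of_nonneg_right (ih (by omega)) (h.pos _ hm.le).le)
          (sq_nonneg t)
      _ = w m * (t ^ (2 * (m + 1) + 1) * w (m + 1)) := by ring

theorem le_pow_sq_mul (h : IsStronglyLogConcave t d w) (ht : 0 ≤ t) (h1 : w 1 ≤ t * w 0)
    (hm : m ≤ d) : w m ≤ t ^ (m ^ 2) * w 0 := by
  induction m with
  | zero => simp
  | succ m ih =>
    calc w (m + 1) ≤ t ^ (2 * m + 1) * w m := h.succ_le_pow_mul h1 hm
      _ ≤ t ^ (2 * m + 1) * (t ^ (m ^ 2) * w 0) :=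
        mul_le_mul_of_nonneg_left (ih (by omega)) (pow_nonneg ht _)
      _ = t ^ ((m + 1) ^ 2) * w 0 := by ring

theorem sum_Icc_le_thetaSum_mul (h : IsStronglyLogConcave t d w) (ht : 0 ≤ t)
    (h1 : w 1 ≤ t * w 0) : ∑ m ∈ Finset.Icc 1 d, w m ≤ thetaSum t d * w 0 := by
  rw [thetaSum, Finset.sum_mul]
  exact Finset.sum_le_sum fun m hm => h.le_pow_sq_mul ht h1 (Finset.mem_Icc.1 hm).2

theorem sum_erase_le (h : IsStronglyLogConcave t d w) (ht : 0 ≤ t) (hj : j + 2 ≤ d)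
    (heq : w j = w (j + 2)) :
    ∑ k ∈ (Finset.range (d + 1)).erase (j + 1), w k ≤
      (thetaSum t (j + 1) + thetaSum t (d - (j + 1))) * w (j + 1) := by
  have hneighbour : w (j + 2) ≤ t * w (j + 1) := by
    have hsq := h.mul_le j hj
    rw [heq, ← pow_two, ← _root_.mul_pow] at hsq
    exact le_of_sq_le_sq hsq (mul_nonneg ht (h.pos _ (by omega)).le)
  have hbelow := (h.reverse (by omega : j + 1 ≤ d)).sum_Icc_le_thetaSum_mul ht
    (by simpa [heq] using hneighbour)
  have habove := (h.shift (by omega : j + 1 ≤ d)).sum_Icc_le_thetaSum_mul ht hneighbour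
  rw [show d = j + 1 + (d - (j + 1)) by omega, sum_range_erase_eq_sum_Icc_add_sum_Icc, add_mul]
  simpa using add_le_add hbelow habove

end IsStronglyLogConcave

theorem exists_isDominantAt_succ {P : ℝ[X]} {t : ℝ} {j : ℕ}
    (h : IsStronglyLogConcave t P.natDegree fun k => |P.coeff k|) (ht : 0 ≤ t)
    (hj : j + 2 ≤ P.natDegree)
    (hS : thetaSum t (j + 1) + thetaSum t (P.natDegree - (j + 1)) < 1) :
    ∃ x, IsDominantAt P (j + 1) x := by
  have hlow := h.pos j (by omega)
  have hhigh := h.pos (j + 2) hj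
  set x := √(|P.coeff j| / |P.coeff (j + 2)|) with hx_def
  have hx : 0 < x := Real.sqrt_pos.2 (div_pos hlow hhigh)
  have hbalance : |P.coeff j| * x ^ j = |P.coeff (j + 2)| * x ^ (j + 2) := by
    rw [pow_add, mul_left_comm, hx_def, Real.sq_sqrt (div_pos hlow hhigh).le]
    field_simp
  have hw := h.mul_pow hx
  exact ⟨x, hx.le, (hw.sum_erase_le ht hj hbalance).trans_lt <|
    mul_lt_of_lt_one_left (hw.pos (j + 1) (by omega)) hS⟩

theorem IsStronglyLogConcave.splits_of_lt_one {P : ℝ[X]} {t : ℝ}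
    (h : IsStronglyLogConcave t P.natDegree fun k => |P.coeff k|) (ht : 0 ≤ t)
    (hS : ∀ j, 1 ≤ j → j < P.natDegree → thetaSum t j + thetaSum t (P.natDegree - j) < 1) :
    P.Splits := by
  refine splits_of_forall_exists_isDominantAt fun j hj => ?_
  rcases hj.eq_or_lt with rfl | hj
  · exact exists_isDominantAt_natDegree fun hP => by simpa [hP] using h.pos 0
  · cases j with
    | zero => exact ⟨0, isDominantAt_zero (abs_pos.1 (h.pos 0 (Nat.zero_le _)))⟩
    | succ j => exact exists_isDominantAt_succ h ht hj (hS _ (Nat.le_add_left 1 j) hj)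

/-- The polynomial with coefficients `a_k θ^{k²}`, where `a_k` are the coefficients of `P`. For
`0 < θ < 1` it has larger second quotients than `P`. -/
noncomputable def gaussianScale {R : Type*} [Semiring R] (P : R[X]) (θ : R) : R[X] :=
  P.sum fun k a => monomial k (a * θ ^ (k ^ 2))

theorem coeff_gaussianScale {R : Type*} [Semiring R] (P : R[X]) (θ : R) (k : ℕ) :
    (gaussianScale P θ).coeff k = P.coeff k * θ ^ (k ^ 2) := by
  simp only [gaussianScale, Polynomial.sum, finsetSum_coeff, coeff_monomial, Finset.sum_ite_eq']
  split_ifs with h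
  · rfl
  · rw [notMem_support_iff.1 h, zero_mul]

theorem natDegree_gaussianScale {R : Type*} [Semiring R] [NoZeroDivisors R] (P : R[X]) {θ : R}
    (hθ : θ ≠ 0) : (gaussianScale P θ).natDegree = P.natDegree :=
  eq_of_forall_ge_iff fun n => by
    simp only [natDegree_le_iff_coeff_eq_zero, coeff_gaussianScale, mul_eq_zero,
      pow_ne_zero _ hθ, or_false]

theorem IsStronglyLogConcave.splits_of_le_one {P : ℝ[X]} {t : ℝ}
    (h : IsStronglyLogConcave t P.natDegree fun k => |P.coeff k|) (ht : 0 < t)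
    (hS : ∀ j, 1 ≤ j → j < P.natDegree → thetaSum t j + thetaSum t (P.natDegree - j) ≤ 1) :
    P.Splits := by
  have hθ : ∀ᶠ θ : ℝ in 𝓝[<] 1, 0 < θ ∧ θ < 1 := Ioo_mem_nhdsLT zero_lt_one
  refine splits_of_tendsto_coeff (F := gaussianScale P) (l := 𝓝[<] 1) (fun k => ?_) ?_ ?_
  · have hlimit : Tendsto (fun θ : ℝ => P.coeff k * θ ^ (k ^ 2)) (𝓝 1) (𝓝 (P.coeff k)) :=
      Continuous.tendsto' (by fun_prop) _ _ (by rw [one_pow, mul_one])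
    simpa only [coeff_gaussianScale] using hlimit.mono_left nhdsWithin_le_nhds
  · exact hθ.mono fun θ hθ => natDegree_gaussianScale P hθ.1.ne'
  · filter_upwards [hθ] with θ ⟨hθ0, hθ1⟩
    have hθt : 0 ≤ θ * t := (mul_pos hθ0 ht).le
    have hlt : θ * t < t := mul_lt_of_lt_one_left ht hθ1
    refine IsStronglyLogConcave.splits_of_lt_one (t := θ * t) ?_ hθt ?_
    · simpa only [natDegree_gaussianScale P hθ0.ne', coeff_gaussianScale, abs_mul, abs_pow,
        abs_of_pos hθ0] using h.mul_pow_sq hθ0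
    · rw [natDegree_gaussianScale P hθ0.ne']
      exact fun j hj hjd => (add_lt_add (thetaSum_lt hθt hlt hj)
        (thetaSum_lt hθt hlt (by omega))).trans_le (hS j hj hjd)

/-! ### The theta root -/

theorem inv_sqrt_pow_sq {b : ℝ} (hb : 0 < b) (k : ℕ) :
    (√b)⁻¹ ^ (k ^ 2) = b ^ (-(k : ℝ) ^ 2 / 2) := by
  rw [Real.sqrt_eq_rpow, ← Real.rpow_neg hb.le, ← Real.rpow_natCast, ← Real.rpow_mul hb.le]
  congr 1
  push_cast
  ring

theorem bEven_pos {n : ℕ} (hn : 1 ≤ n) : 0 < bEven n := (bEven_spec n hn).1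

theorem two_mul_thetaSum_bEven {n : ℕ} (hn : 1 ≤ n) : 2 * thetaSum (√(bEven n))⁻¹ n = 1 := by
  simp only [thetaSum, inv_sqrt_pow_sq (bEven_pos hn)]
  exact (sub_eq_zero.1 (bEven_spec n hn).2).symm

theorem inv_sqrt_bEven_le_one {n : ℕ} (hn : 1 ≤ n) : (√(bEven n))⁻¹ ≤ 1 :=
  calc (√(bEven n))⁻¹ = thetaSum (√(bEven n))⁻¹ 1 := by simp [thetaSum]
    _ ≤ thetaSum (√(bEven n))⁻¹ n := thetaSum_mono (by positivity) hn
    _ ≤ 1 := by linarith [two_mul_thetaSum_bEven hn]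

theorem one_lt_two_mul_thetaSum {n : ℕ} (hn : 1 ≤ n) {β : ℝ} (hβ : 0 < β) (hβn : β < bEven n) :
    1 < 2 * thetaSum (√β)⁻¹ n := by
  have hlt : (√(bEven n))⁻¹ < (√β)⁻¹ :=
    inv_strictAnti₀ (Real.sqrt_pos.2 hβ) (Real.sqrt_lt_sqrt hβ.le hβn)
  linarith [thetaSum_lt (by positivity) hlt hn, two_mul_thetaSum_bEven hn]

namespace HasDegreeAndNonzeroCoeffs

variable {P : ℝ[X]} {d : ℕ} {b : ℝ}

theorem ne_zero (hP : HasDegreeAndNonzeroCoeffs P d) : P ≠ 0 := fun h =>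
  hP.2 0 (Nat.zero_le d) (by rw [h, coeff_zero])

theorem isStronglyLogConcave (hP : HasDegreeAndNonzeroCoeffs P d) (hb : 0 < b)
    (hq : ∀ k ∈ Finset.Icc 2 d, b ≤ |secondQuotient P k|) :
    IsStronglyLogConcave (√b)⁻¹ d fun k => |P.coeff k| where
  pos k hk := abs_pos.2 (hP.2 k hk)
  mul_le k hk := by
    have hprod : 0 < |P.coeff k| * |P.coeff (k + 2)| :=
      mul_pos (abs_pos.2 (hP.2 k (by omega))) (abs_pos.2 (hP.2 (k + 2) hk))
    have hquot : b ≤ |P.coeff (k + 1)| ^ 2 / (|P.coeff k| * |P.coeff (k + 2)|) := by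
      rw [← abs_pow, ← abs_mul, ← abs_div]
      exact hq (k + 2) (Finset.mem_Icc.2 ⟨Nat.le_add_left 2 k, hk⟩)
    rw [inv_pow, Real.sq_sqrt hb.le, inv_mul_eq_div, le_div_iff₀' hb]
    exact (le_div_iff₀ hprod).1 hquot

end HasDegreeAndNonzeroCoeffs

theorem allZerosReal_of_bEven_le {n d : ℕ} (hn : 1 ≤ n) (hd : d ≤ 2 * n) {P : ℝ[X]}
    (hP : HasDegreeAndNonzeroCoeffs P d)
    (hq : ∀ k ∈ Finset.Icc 2 d, bEven n ≤ |secondQuotient P k|) : AllZerosReal P := by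
  have ht : 0 < (√(bEven n))⁻¹ := inv_pos.2 (Real.sqrt_pos.2 (bEven_pos hn))
  have hconcave := hP.isStronglyLogConcave (bEven_pos hn) hq
  rw [allZerosReal_iff_splits hP.ne_zero]
  obtain ⟨rfl, -⟩ := hP
  refine hconcave.splits_of_le_one ht fun j _ hj => ?_
  rw [← two_mul_thetaSum_bEven hn]
  exact thetaSum_add_thetaSum_le ht.le (inv_sqrt_bEven_le_one hn) (by omega)

/-! ### Sharpness -/

/-- The extremal polynomial of degree `d`: its coefficients are `± s ^ (k ^ 2)`, with a plus sign
for `k = n` only. -/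
noncomputable def peakPolynomial (s : ℝ) (n d : ℕ) : ℝ[X] :=
  ∑ k ∈ Finset.range (d + 1), monomial k (if k = n then s ^ (k ^ 2) else -s ^ (k ^ 2))

section PeakPolynomial

variable {s x : ℝ} {n d k : ℕ}

theorem coeff_peakPolynomial (hk : k ≤ d) :
    (peakPolynomial s n d).coeff k = if k = n then s ^ (k ^ 2) else -s ^ (k ^ 2) := by
  rw [peakPolynomial, finsetSum_coeff]
  simp only [coeff_monomial, Finset.sum_ite_eq', Finset.mem_range_succ_iff, hk, if_true]

theorem abs_coeff_peakPolynomial (hs : 0 < s) (hk : k ≤ d) :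
    |(peakPolynomial s n d).coeff k| = s ^ (k ^ 2) := by
  rw [coeff_peakPolynomial hk]
  split_ifs
  · exact abs_of_pos (pow_pos hs _)
  · rw [abs_neg, abs_of_pos (pow_pos hs _)]

theorem hasDegreeAndNonzeroCoeffs_peakPolynomial (hs : 0 < s) :
    HasDegreeAndNonzeroCoeffs (peakPolynomial s n d) d := by
  have hcoeff : ∀ k ≤ d, (peakPolynomial s n d).coeff k ≠ 0 := fun k hk =>
    abs_pos.1 (by rw [abs_coeff_peakPolynomial hs hk]; exact pow_pos hs _)
  refine ⟨le_antisymm ?_ (le_natDegree_of_ne_zero (hcoeff d le_rfl)), hcoeff⟩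
  exact natDegree_sum_le_of_forall_le _ _ fun k hk =>
    (natDegree_monomial_le _).trans (Finset.mem_range_succ_iff.1 hk)

theorem abs_secondQuotient_peakPolynomial (hs : 0 < s) (hk : k ∈ Finset.Icc 2 d) :
    |secondQuotient (peakPolynomial s n d) k| = (s ^ 2)⁻¹ := by
  obtain ⟨hk2, hkd⟩ := Finset.mem_Icc.1 hk
  obtain ⟨i, rfl⟩ := Nat.exists_eq_add_of_le' hk2
  rw [secondQuotient, abs_div, abs_mul, abs_pow, abs_coeff_peakPolynomial hs (by omega),
    abs_coeff_peakPolynomial hs (by omega), abs_coeff_peakPolynomial hs hkd,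
    Nat.add_sub_cancel, show i + 2 - 1 = i + 1 from rfl]
  field_simp
  ring

theorem eval_peakPolynomial (hn : n ≤ d) :
    (peakPolynomial s n d).eval x = s ^ (n ^ 2) * x ^ n -
      ∑ k ∈ (Finset.range (d + 1)).erase n, s ^ (k ^ 2) * x ^ k := by
  simp only [peakPolynomial, eval_finsetSum, eval_monomial]
  rw [← Finset.add_sum_erase _ _ (Finset.mem_range_succ_iff.2 hn), if_pos rfl, sub_eq_add_neg,
    ← Finset.sum_neg_distrib]
  refine congrArg _ (Finset.sum_congr rfl fun k hk => ?_)
  rw [if_neg (Finset.ne_of_mem_erase hk), neg_mul]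

theorem two_mul_thetaSum_mul_le_sum_erase (hs : 0 ≤ s) (hx : 0 ≤ x) (hd : 2 * n ≤ d) :
    2 * thetaSum s n * (s ^ (n ^ 2) * x ^ n) ≤
      ∑ k ∈ (Finset.range (d + 1)).erase n, s ^ (k ^ 2) * x ^ k := by
  have hterm : ∀ k, 0 ≤ s ^ (k ^ 2) * x ^ k := fun k =>
    mul_nonneg (pow_nonneg hs _) (pow_nonneg hx _)
  have hpair : ∀ m ∈ Finset.Icc 1 n, 2 * s ^ (m ^ 2) * (s ^ (n ^ 2) * x ^ n) ≤
      s ^ ((n - m) ^ 2) * x ^ (n - m) + s ^ ((n + m) ^ 2) * x ^ (n + m) := fun m hm => by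
    obtain ⟨i, rfl⟩ := Nat.exists_eq_add_of_le' (Finset.mem_Icc.1 hm).2
    rw [Nat.add_sub_cancel, mul_assoc]
    exact two_mul_le_add_of_sq_le_mul (hterm i) (hterm (i + m + m)) (by ring_nf; rfl)
  calc 2 * thetaSum s n * (s ^ (n ^ 2) * x ^ n)
      = ∑ m ∈ Finset.Icc 1 n, 2 * s ^ (m ^ 2) * (s ^ (n ^ 2) * x ^ n) := by
        rw [thetaSum, Finset.mul_sum, Finset.sum_mul]
    _ ≤ ∑ k ∈ (Finset.range (n + n + 1)).erase n, s ^ (k ^ 2) * x ^ k := by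
        rw [sum_range_erase_eq_sum_Icc_add_sum_Icc, ← Finset.sum_add_distrib]
        exact Finset.sum_le_sum hpair
    _ ≤ ∑ k ∈ (Finset.range (d + 1)).erase n, s ^ (k ^ 2) * x ^ k :=
        Finset.sum_le_sum_of_subset_of_nonneg
          (Finset.erase_subset_erase _ (Finset.range_subset_range.2 (by omega)))
          fun k _ _ => hterm k

theorem eval_peakPolynomial_neg (hs : 0 < s) (hx : 0 < x) (hd : 2 * n ≤ d)
    (hS : 1 < 2 * thetaSum s n) : (peakPolynomial s n d).eval x < 0 := by
  rw [eval_peakPolynomial (by omega), sub_neg]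
  exact (lt_mul_of_one_lt_left (by positivity) hS).trans_le
    (two_mul_thetaSum_mul_le_sum_erase hs.le hx.le hd)

theorem hasNonrealZero_peakPolynomial (hs : 0 < s) (hn : 1 ≤ n) (hd : 2 * n ≤ d)
    (hS : 1 < 2 * thetaSum s n) : HasNonrealZero (peakPolynomial s n d) := by
  have hP := hasDegreeAndNonzeroCoeffs_peakPolynomial (n := n) (d := d) hs
  rw [hasNonrealZero_iff_not_splits hP.ne_zero]
  intro hsplits
  have hsign := leadingCoeff_mul_coeff_nonneg_of_splits hsplits
    (fun x hx => (eval_peakPolynomial_neg hs hx hd hS).ne) n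
  rw [leadingCoeff, hP.1, coeff_peakPolynomial le_rfl, coeff_peakPolynomial (by omega),
    if_neg (by omega), if_pos rfl, neg_mul] at hsign
  linarith [mul_pos (pow_pos hs (d ^ 2)) (pow_pos hs (n ^ 2))]

end PeakPolynomial

theorem exists_hasNonrealZero {n d : ℕ} (hn : 1 ≤ n) (hd : 2 * n ≤ d) {ε : ℝ} (hε : 0 < ε) :
    ∃ P : ℝ[X], HasDegreeAndNonzeroCoeffs P d ∧
      (∀ k ∈ Finset.Icc 2 d, bEven n - ε < |secondQuotient P k|) ∧ HasNonrealZero P := by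
  obtain ⟨β, hβ, hβn⟩ := exists_between (max_lt (sub_lt_self (bEven n) hε) (bEven_pos hn))
  obtain ⟨hβε, hβ0⟩ := max_lt_iff.1 hβ
  have hs : 0 < (√β)⁻¹ := inv_pos.2 (Real.sqrt_pos.2 hβ0)
  refine ⟨peakPolynomial (√β)⁻¹ n d, hasDegreeAndNonzeroCoeffs_peakPolynomial hs, fun k hk => ?_,
    hasNonrealZero_peakPolynomial hs hn hd (one_lt_two_mul_thetaSum hn hβ0 hβn)⟩
  rwa [abs_secondQuotient_peakPolynomial hs hk, inv_pow, Real.sq_sqrt hβ0.le, inv_inv]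

/-! ### Cubic polynomials -/

/-- The discriminant of a cubic divided by the square of the product of its two middle coefficients,
as a function of `u = 1 / q_2` and `v = 1 / q_3`. -/
def normalizedCubicDiscr {R : Type*} [Ring R] (u v : R) : R :=
  1 - 4 * u - 4 * v + 18 * (u * v) - 27 * (u * v) ^ 2

theorem normalizedCubicDiscr_comm {R : Type*} [CommRing R] (u v : R) :
    normalizedCubicDiscr u v = normalizedCubicDiscr v u := by
  unfold normalizedCubicDiscr
  ring

section NormalizedCubicDiscr

variable {K : Type*} [Field K] [LinearOrder K] [IsStrictOrderedRing K] {t u v x y : K}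

-- The value decreases in `y`; at `y = t` it is concave in `x`, so only `x = 0` and `x = t` matter.
theorem normalizedCubicDiscr_neg_left_nonneg (ht : 18 * t ^ 2 + 27 * t ^ 4 ≤ 1)
    (hx : x ∈ Set.Icc 0 t) (hy : y ∈ Set.Icc 0 t) : 0 ≤ normalizedCubicDiscr (-x) y := by
  obtain ⟨hx0, hxt⟩ := hx
  obtain ⟨hy0, hyt⟩ := hy
  rcases hy0.eq_or_lt with rfl | hypos
  · calc 0 ≤ 1 + 4 * x := by linarith
      _ = normalizedCubicDiscr (-x) 0 := by
        unfold normalizedCubicDiscr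
        ring
  have htpos : 0 < t := hypos.trans_le hyt
  have ht4 : 4 * t ≤ 1 := by nlinarith [sq_nonneg (t ^ 2)]
  have hmono : x * y ≤ x * t := mul_le_mul_of_nonneg_left hyt hx0
  have hmono_sq : (x * y) ^ 2 ≤ (x * t) ^ 2 := pow_le_pow_left₀ (mul_nonneg hx0 hypos.le) hmono 2
  have hend : 0 ≤ t * normalizedCubicDiscr (-x) t :=
    calc 0 ≤ (t - x) * (1 - 4 * t) + 27 * t ^ 3 * (x * (t - x)) +
          x * (1 - (18 * t ^ 2 + 27 * t ^ 4)) := by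
          rw [← sub_nonneg] at hxt ht4 ht
          positivity
      _ = t * normalizedCubicDiscr (-x) t := by
          unfold normalizedCubicDiscr
          ring
  calc 0 ≤ normalizedCubicDiscr (-x) t := nonneg_of_mul_nonneg_right hend htpos
    _ ≤ normalizedCubicDiscr (-x) y := by
        unfold normalizedCubicDiscr
        linarith

theorem normalizedCubicDiscr_nonneg_of_mul_nonneg (ht : 18 * t ^ 2 + 27 * t ^ 4 ≤ 1)
    (hu : |u| ≤ t) (hv : |v| ≤ t) (huv : 0 ≤ u * v) : 0 ≤ normalizedCubicDiscr u v := by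
  have hprod : u * v ≤ t ^ 2 := by
    rw [← abs_of_nonneg huv, abs_mul, pow_two]
    exact mul_le_mul hu hv (abs_nonneg v) ((abs_nonneg u).trans hu)
  have ht4 : 4 * t ≤ 1 := by nlinarith [sq_nonneg (t ^ 2)]
  have hu4 : 0 ≤ 1 - 4 * u := by linarith [le_abs_self u]
  have hv4 : 0 ≤ 1 - 4 * v := by linarith [le_abs_self v]
  have huv27 : 0 ≤ 2 - 27 * (u * v) := by linarith [sq_nonneg (t ^ 2)]
  calc 0 ≤ (1 - 4 * u) * (1 - 4 * v) + u * v * (2 - 27 * (u * v)) := by positivity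
    _ = normalizedCubicDiscr u v := by
      unfold normalizedCubicDiscr
      ring

theorem normalizedCubicDiscr_nonneg (ht : 18 * t ^ 2 + 27 * t ^ 4 ≤ 1) (hu : |u| ≤ t)
    (hv : |v| ≤ t) : 0 ≤ normalizedCubicDiscr u v := by
  rcases le_total 0 (u * v) with huv | huv
  · exact normalizedCubicDiscr_nonneg_of_mul_nonneg ht hu hv huv
  wlog h : u ≤ v generalizing u v
  · rw [normalizedCubicDiscr_comm]
    exact this hv hu (by rwa [mul_comm]) (le_of_not_ge h)
  have hu0 : u ≤ 0 := by
    by_contra! hu0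
    exact (mul_pos hu0 (hu0.trans_le h)).not_ge huv
  have hv0 : 0 ≤ v := by
    by_contra! hv0
    exact (mul_pos_of_neg_of_neg (h.trans_lt hv0) hv0).not_ge huv
  rw [← neg_neg u]
  exact normalizedCubicDiscr_neg_left_nonneg ht ⟨neg_nonneg.2 hu0, (neg_le_abs u).trans hu⟩
    ⟨hv0, (le_abs_self v).trans hv⟩

end NormalizedCubicDiscr

section Cubic

variable {T : Cubic ℝ}

-- The third zero `r` satisfies `T.a * (z.re - r) = T.b + 3 * T.a * z.re`.
theorem discr_eq_of_aeval_toPoly_eq_zero {z : ℂ} (hz : aeval z T.toPoly = 0) (him : z.im ≠ 0) :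
    T.discr = -(4 * z.im ^ 2 * ((T.b + 3 * T.a * z.re) ^ 2 + (T.a * z.im) ^ 2) ^ 2) := by
  have hz' : T.a * z ^ 3 + T.b * z ^ 2 + T.c * z + T.d = 0 := by
    simpa [Cubic.toPoly] using hz
  obtain ⟨x, y⟩ := z
  have hre : T.a * (x ^ 3 - 3 * x * y ^ 2) + T.b * (x ^ 2 - y ^ 2) + T.c * x + T.d = 0 := by
    rw [← Complex.zero_re, ← hz']
    simp only [Complex.add_re, Complex.mul_re, Complex.mul_im, Complex.ofReal_re, Complex.ofReal_im,
      pow_succ, pow_zero, one_mul]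
    ring
  have him' : (T.a * (3 * x ^ 2 - y ^ 2) + 2 * T.b * x + T.c) * y = 0 := by
    rw [← Complex.zero_im, ← hz']
    simp only [Complex.add_im, Complex.mul_re, Complex.mul_im, Complex.ofReal_re, Complex.ofReal_im,
      pow_succ, pow_zero, one_mul]
    ring
  have hc : T.c = -(T.a * (3 * x ^ 2 - y ^ 2) + 2 * T.b * x) :=
    eq_neg_of_add_eq_zero_right ((mul_eq_zero.1 him').resolve_right him)
  have hd : T.d = -(T.a * (x ^ 3 - 3 * x * y ^ 2) + T.b * (x ^ 2 - y ^ 2) + T.c * x) :=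
    eq_neg_of_add_eq_zero_right hre
  rw [Cubic.discr, hd, hc]
  ring

theorem splits_toPoly_iff_discr_nonneg (ha : T.a ≠ 0) : T.toPoly.Splits ↔ 0 ≤ T.discr := by
  refine ⟨fun h => ?_, fun h => ?_⟩
  · obtain ⟨x, y, z, hroots⟩ :=
      (Cubic.splits_iff_roots_eq_three (φ := RingHom.id ℝ) ha).1 (by rwa [Polynomial.map_id])
    rw [← RingHom.id_apply T.discr, Cubic.discr_eq_prod_three_roots ha hroots]
    exact sq_nonneg _
  · refine (allZerosReal_iff_splits (Cubic.ne_zero_of_a_ne_zero ha)).1 fun z hz => ?_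
    by_contra him
    rw [discr_eq_of_aeval_toPoly_eq_zero hz him] at h
    have hpos : 0 < 4 * z.im ^ 2 * ((T.b + 3 * T.a * z.re) ^ 2 + (T.a * z.im) ^ 2) ^ 2 := by
      positivity
    linarith

theorem discr_eq_sq_mul_normalizedCubicDiscr (hb : T.b ≠ 0) (hc : T.c ≠ 0) :
    T.discr = (T.b * T.c) ^ 2 * normalizedCubicDiscr
      (secondQuotient T.toPoly 2)⁻¹ (secondQuotient T.toPoly 3)⁻¹ := by
  simp only [secondQuotient, inv_div, Nat.reduceSub, Cubic.coeff_eq_a, Cubic.coeff_eq_b,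
    Cubic.coeff_eq_c, Cubic.coeff_eq_d, Cubic.discr, normalizedCubicDiscr]
  field_simp
  ring

end Cubic

theorem eighteen_mul_inv_sqrt_sq_add :
    18 * (√(9 + 6 * √3))⁻¹ ^ 2 + 27 * (√(9 + 6 * √3))⁻¹ ^ 4 = 1 := by
  have h3 : √3 ^ 2 = 3 := Real.sq_sqrt (by norm_num)
  have hsq : (√(9 + 6 * √3))⁻¹ ^ 2 = (9 + 6 * √3)⁻¹ := by
    rw [inv_pow, Real.sq_sqrt (by positivity)]
  rw [show (√(9 + 6 * √3))⁻¹ ^ 4 = ((√(9 + 6 * √3))⁻¹ ^ 2) ^ 2 by ring, hsq]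
  field_simp
  linear_combination -36 * h3

theorem allZerosReal_of_sqrt_le {P : ℝ[X]} (hP : HasDegreeAndNonzeroCoeffs P 3)
    (hq : ∀ k ∈ Finset.Icc 2 3, √(9 + 6 * √3) ≤ |secondQuotient P k|) : AllZerosReal P := by
  obtain ⟨T, rfl⟩ : ∃ T : Cubic ℝ, T.toPoly = P :=
    ⟨Cubic.equiv.symm ⟨P, natDegree_le_iff_degree_le.1 hP.1.le⟩,
      congrArg Subtype.val (Cubic.equiv.apply_symm_apply _)⟩
  have ha : T.a ≠ 0 := by simpa using hP.2 3 le_rfl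
  have hb : T.b ≠ 0 := by simpa using hP.2 2 (by norm_num)
  have hc : T.c ≠ 0 := by simpa using hP.2 1 (by norm_num)
  have hinv : ∀ k ∈ Finset.Icc 2 3, |(secondQuotient T.toPoly k)⁻¹| ≤ (√(9 + 6 * √3))⁻¹ :=
    fun k hk => by
      rw [abs_inv]
      exact inv_anti₀ (by positivity) (hq k hk)
  rw [allZerosReal_iff_splits hP.ne_zero, splits_toPoly_iff_discr_nonneg ha,
    discr_eq_sq_mul_normalizedCubicDiscr hb hc]
  exact mul_nonneg (sq_nonneg _) <| normalizedCubicDiscr_nonneg eighteen_mul_inv_sqrt_sq_add.le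
    (hinv 2 (by decide)) (hinv 3 (by decide))

theorem discr_neg_of_sq_lt {s : ℝ} (hs : s ^ 2 < 9 + 6 * √3) :
    (⟨1, -s, s, 1⟩ : Cubic ℝ).discr < 0 := by
  have h3 : √3 ^ 2 = 3 := Real.sq_sqrt (by norm_num)
  have hsqrt : 3 / 2 < √3 := Real.lt_sqrt_of_sq_lt (by norm_num)
  calc (⟨1, -s, s, 1⟩ : Cubic ℝ).discr
      = (s ^ 2 - (9 + 6 * √3)) * (s ^ 2 + (6 * √3 - 9)) := by
        rw [Cubic.discr]
        linear_combination 36 * h3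
    _ < 0 := mul_neg_of_neg_of_pos (sub_neg.2 hs) (by linarith [sq_nonneg s])

theorem exists_cubic_hasNonrealZero {ε : ℝ} (hε : 0 < ε) :
    ∃ P : ℝ[X], HasDegreeAndNonzeroCoeffs P 3 ∧
      (∀ k ∈ Finset.Icc 2 3, √(9 + 6 * √3) - ε < |secondQuotient P k|) ∧ HasNonrealZero P := by
  have hpos : 0 < √(9 + 6 * √3) := by positivity
  obtain ⟨s, hs, hs_lt⟩ := exists_between (max_lt (sub_lt_self (√(9 + 6 * √3)) hε) hpos)
  obtain ⟨hsε, hs0⟩ := max_lt_iff.1 hs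
  have hdegree : HasDegreeAndNonzeroCoeffs (⟨1, -s, s, 1⟩ : Cubic ℝ).toPoly 3 := by
    refine ⟨Cubic.natDegree_of_a_ne_zero one_ne_zero, fun k hk => ?_⟩
    interval_cases k <;> simp [hs0.ne']
  refine ⟨_, hdegree, fun k hk => ?_, ?_⟩
  · have hquot : |secondQuotient (⟨1, -s, s, 1⟩ : Cubic ℝ).toPoly k| = s := by
      obtain ⟨hk2, hk3⟩ := Finset.mem_Icc.1 hk
      interval_cases k <;> simp [secondQuotient, abs_div, abs_of_pos hs0, pow_two, hs0.ne']
    rwa [hquot]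
  · rw [hasNonrealZero_iff_not_splits hdegree.ne_zero, splits_toPoly_iff_discr_nonneg one_ne_zero,
      not_le]
    exact discr_neg_of_sq_lt ((Real.lt_sqrt hs0.le).1 hs_lt)

theorem theorem4 :
    -- degree `2n`
    (∀ n : ℕ, 1 ≤ n → ∀ P : ℝ[X], HasDegreeAndNonzeroCoeffs P (2 * n) →
      (∀ k ∈ Finset.Icc 2 (2 * n), bEven n ≤ |secondQuotient P k|) → AllZerosReal P) ∧
    (∀ n : ℕ, 1 ≤ n → ∀ ε : ℝ, 0 < ε → ∃ P : ℝ[X], HasDegreeAndNonzeroCoeffs P (2 * n) ∧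
      (∀ k ∈ Finset.Icc 2 (2 * n), bEven n - ε < |secondQuotient P k|) ∧ HasNonrealZero P) ∧
    -- degree `2n + 1`; here `bEven (n + 1)` is `b_{2n+2}`
    (∀ n : ℕ, 1 ≤ n → ∀ P : ℝ[X], HasDegreeAndNonzeroCoeffs P (2 * n + 1) →
      (∀ k ∈ Finset.Icc 2 (2 * n + 1), bEven (n + 1) ≤ |secondQuotient P k|) →
        AllZerosReal P) ∧
    (∀ n : ℕ, 1 ≤ n → ∀ ε : ℝ, 0 < ε → ∃ P : ℝ[X], HasDegreeAndNonzeroCoeffs P (2 * n + 1) ∧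
      (∀ k ∈ Finset.Icc 2 (2 * n + 1), bEven n - ε < |secondQuotient P k|) ∧
        HasNonrealZero P) ∧
    -- degree `3`
    (∀ P : ℝ[X], HasDegreeAndNonzeroCoeffs P 3 →
      (∀ k ∈ Finset.Icc 2 3, √(9 + 6 * √3) ≤ |secondQuotient P k|) → AllZerosReal P) ∧
    (∀ ε : ℝ, 0 < ε → ∃ P : ℝ[X], HasDegreeAndNonzeroCoeffs P 3 ∧
      (∀ k ∈ Finset.Icc 2 3, √(9 + 6 * √3) - ε < |secondQuotient P k|) ∧
        HasNonrealZero P) := by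
  refine ⟨fun n hn P hP hq => allZerosReal_of_bEven_le hn le_rfl hP hq,
    fun n hn ε hε => exists_hasNonrealZero hn le_rfl hε,
    fun n _ P hP hq => allZerosReal_of_bEven_le (by omega) (by omega) hP hq,
    fun n hn ε hε => exists_hasNonrealZero hn (by omega) hε,
    fun P hP hq => allZerosReal_of_sqrt_le hP hq,
    fun ε hε => exists_cubic_hasNonrealZero hε⟩
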